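/- **Setting.** Let $B$ be a unital complex algebra. A $B$-$B$-bimodule with specified $B$-projection is a direct sum of $B$-$B$-bimodules $\mathcal X=B\oplus\mathring{\mathcal X}$ with $p(b\oplus\eta)=b$; $\mathcal L(\mathcal X)$ is the algebra of $\mathbb C$-linear maps on $\mathcal X$, with expectation $E_{\mathcal L(\mathcal X)}(T)=p(T(1_B\oplus 0))$; $L_b,R_b$ are left and right multiplication by $b$; $\mathcal L_\ell(\mathcal X)$ (resp. $\mathcal L_r(\mathcal X)$) is the commutant of all $R_b$ (resp. of all $L_b$). A $B$-$B$-non-commutative probability space $(\mathcal A,E,\varepsilon)$ is a unital complex algebra $\mathcal A$ with a unital homomorphism $\varepsilon:B\otimes B^{\mathrm{op}}\to\mathcal A$, injective on $B\otimes 1$ and on $1\otimes B^{\mathrm{op}}$, and a linear map $E:\mathcal A\to B$ with $E(\varepsilon(b_1\otimes b_2)T)=b_1E(T)b_2$ and $E(T\varepsilon(b\otimes 1))=E(T\varepsilon(1\otimes b))$; put $L_b=\varepsilon(b\otimes1)$, $R_b=\varepsilon(1\otimes b)$, and let $\mathcal A_\ell,\mathcal A_r$ be the commutants of all $R_b$,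 resp. of all $L_b$. A triple of $B$-faces is $(A^\ell,A^r,A^b)$ with $A^\ell,A^r$ unital subalgebras and $A^b$ a (not necessarily unital) subalgebra of $\mathcal A$, such that $L_B\subseteq A^\ell\subseteq\mathcal A_\ell$, $R_B\subseteq A^r\subseteq\mathcal A_r$ and $L_BA^bL_B\subseteq A^b\subseteq\mathcal A_\ell$. The joint distribution of a triple, or of a family of triples, is the collection of moments $E(Z_1\cdots Z_n)$ of words of elements of its algebras. Two joint distributions of families with corresponding elements are equal if the moments of corresponding words are equal. A representation of a triple $(A^\ell,A^r,A^b)$ on $\mathcal X$ consists of unital homomorphisms $\ell:A^\ell\to\mathcal L_\ell(\mathcal X)$ and $r:A^r\to\mathcal L_r(\mathcal X)$ with $\ell(L_b)=L_b$ and $r(R_b)=R_b$ for all $b\in B$, and a not necessarily unital homomorphism $m:A^b\to\mathcal L(\mathcal X)$. Given a family of representations $(\ell_k,r_k,m_k)$ of triples $(A^\ell_k,A^r_k,A^b_k)$ on $\mathcal X_k$, $k\in K$, let $\mathcal X=B\oplus\bigoplus_{n\ge1}\bigoplus_{k_1\ne k_2\ne\cdots\ne k_n}\mathring{\mathcal X}_{k_1}\otimes_B\cdots\otimes_B\mathring{\mathcal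 X}_{k_n}$ be the reduced free product, $\lambda_k,\rho_k$ the left and right regular representations on $\mathcal X$, and $P_k$ the projection of $\mathcal X$ onto $\mathcal X_k=B\oplus\mathring{\mathcal X}_k$; $P_k\lambda_k(T)P_k$ is the operator acting as $T$ on $\mathcal X_k$ and as $0$ on the other summands. A family $\Gamma=\{(A^\ell_k,A^r_k,A^b_k)\}_{k\in K}$ of triples of $B$-faces in $\mathcal A$ is free-free-Boolean independent over $B$ *via* these representations if its joint distribution $\mu_\Gamma$ equals the joint distribution of $$\{(\lambda_k(\ell_k(A^\ell_k)),\ \rho_k(r_k(A^r_k)),\ P_k\lambda_k(m_k(A^b_k))P_k)\}_{k\in K}$$ in $(\mathcal L(\mathcal X),E_{\mathcal L(\mathcal X)})$; it is free-free-Boolean independent over $B$ if it is so via some family of representations. **Proposition.** Let $\Gamma=\{(A^\ell_k,A^r_k,A^b_k)\}_{k\in K}$ be a family of triples of $B$-faces in a $B$-$B$-non-commutative probability space $(\mathcal A,E,\varepsilon)$. For each $k\in K$ let $(\ell'_k,r'_k,m'_k)$ be a representation of the $k$-th triple on a $B$-$B$-bimodule with specified projection $\mathcal X'_k$, such that the joint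 distribution of $(A^\ell_k,A^r_k,A^b_k)$ equals that of $(\ell'_k(A^\ell_k),r'_k(A^r_k),m'_k(A^b_k))$ in $\mathcal L(\mathcal X'_k)$. Then: 1. $\Gamma$ is free-free-Boolean independent over $B$ if and only if it is so via the given representations $(\ell'_k,r'_k,m'_k)_{k\in K}$. 2. In this case $\mu_\Gamma$ equals the joint distribution of the re-represented family $\{(\lambda_k(\ell'_k(A^\ell_k)),\rho_k(r'_k(A^r_k)),P_k\lambda_k(m'_k(A^b_k))P_k)\}_{k\in K}$ on the reduced free product of the $\mathcal X'_k$. 3. Let, moreover, $\Gamma'$ be a family, indexed by $K$, of triples of $B$-faces in a further $B$-$B$-non-commutative probability space, whose $k$-th triple is the image of the $k$-th triple of $\Gamma$ under homomorphisms of its three algebras (unital on $A^\ell_k$ and $A^r_k$, and carrying $L_b\in A_k^\ell$ to $L_b$ and $R_b\in A_k^r$ to $R_b$), with the same joint distribution for each single $k$. If $\Gamma$ and $\Gamma'$ are both free-free-Boolean independent over $B$, then their joint distributions are equal. If their joint distributions are equal, then $\Gamma$ is free-free-Boolean independent over $B$ if and only if $\Gamma'$ is. -/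

import Mathlib

open scoped TensorProduct DirectSum
open MulOpposite

universe u v

noncomputable section

namespace FFB

/-! ## Bimodules with specified projection -/

/-- A `B`-`B`-bimodule (for a unital complex algebra `B`): commuting left and right actions of `B`,
the right action being written as an action of `Bᵐᵒᵖ`, both inducing the same action of `ℂ`. -/
structure Bimod (B : Type u) [Ring B] [Algebra ℂ B] where
  carrier : Type u
  [addCommGroup : AddCommGroup carrier]
  [moduleComplex : Module ℂ carrier]
  [moduleLeft : Module B carrier]
  [moduleRight : Module Bᵐᵒᵖ carrier]
  [commActions : SMulCommClass B Bᵐᵒᵖ carrier]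
  [towerLeft : IsScalarTower ℂ B carrier]
  [towerRight : IsScalarTower ℂ Bᵐᵒᵖ carrier]

attribute [instance] Bimod.addCommGroup Bimod.moduleComplex Bimod.moduleLeft Bimod.moduleRight
  Bimod.commActions Bimod.towerLeft Bimod.towerRight

section Basic

variable {B : Type u} [Ring B] [Algebra ℂ B]

/-- The bimodule with specified projection `𝒳 = B ⊕ M`; here `M` is the complement `𝒳°`, the
projection `p : 𝒳 → B` is the first coordinate, and both actions of `B` are componentwise. -/
abbrev Bimod.Total (M : Bimod B) : Type u := B × M.carrier

/-- The algebra `ℒ(𝒳)` of all `ℂ`-linear maps on `𝒳 = B ⊕ M`. -/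
abbrev Bimod.Op (M : Bimod B) : Type u := Module.End ℂ M.Total

/-- The expectation `T ↦ p (T (1_B ⊕ 0))` on the linear operators of a direct sum `B ⊕ N`. -/
def vacuumExp {N : Type*} [AddCommGroup N] [Module ℂ N] (T : Module.End ℂ (B × N)) : B :=
  (T (1, 0)).1

theorem left_smul_complex (M : Bimod B) (b : B) (c : ℂ) (x : M.carrier) :
    b • c • x = c • b • x := by
  rw [← one_smul B x, ← smul_assoc c (1 : B) x, smul_smul, smul_smul, ← smul_assoc]
  simp

theorem right_smul_complex (M : Bimod B) (b : Bᵐᵒᵖ) (c : ℂ) (x : M.carrier) :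
    b • c • x = c • b • x := by
  rw [← one_smul Bᵐᵒᵖ x, ← smul_assoc c (1 : Bᵐᵒᵖ) x, smul_smul, smul_smul, ← smul_assoc]
  simp

/-- `L_b ∈ ℒ(𝒳)`, left multiplication by `b`. -/
def Bimod.L (M : Bimod B) (b : B) : M.Op where
  toFun x := b • x
  map_add' := smul_add b
  map_smul' c x := by
    ext
    · simp
    · simp [left_smul_complex]

/-- `R_b ∈ ℒ(𝒳)`, right multiplication by `b`. -/
def Bimod.R (M : Bimod B) (b : B) : M.Op where
  toFun x := op b • x
  map_add' := smul_add (op b)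
  map_smul' c x := by
    ext
    · simp
    · simp [right_smul_complex]

/-- The left algebra `ℒ_ℓ(𝒳)`: operators commuting with all right multiplications `R_b`. -/
def Bimod.leftAlg (M : Bimod B) : Subalgebra ℂ M.Op :=
  Subalgebra.centralizer ℂ (Set.range M.R)

/-- The right algebra `ℒ_r(𝒳)`: operators commuting with all left multiplications `L_b`. -/
def Bimod.rightAlg (M : Bimod B) : Subalgebra ℂ M.Op :=
  Subalgebra.centralizer ℂ (Set.range M.L)

theorem leftAlg_apply {M : Bimod B} (a : M.leftAlg) (b : B) (x : M.Total) :
    (a : M.Op) (op b • x) = op b • (a : M.Op) x :=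
  (LinearMap.congr_fun ((Subalgebra.mem_centralizer_iff ℂ).1 a.2 (M.R b) ⟨b, rfl⟩) x).symm

theorem rightAlg_apply {M : Bimod B} (a : M.rightAlg) (b : B) (x : M.Total) :
    (a : M.Op) (b • x) = b • (a : M.Op) x :=
  (LinearMap.congr_fun ((Subalgebra.mem_centralizer_iff ℂ).1 a.2 (M.L b) ⟨b, rfl⟩) x).symm

theorem L_mem_leftAlg (M : Bimod B) (b : B) : M.L b ∈ M.leftAlg := by
  rw [Bimod.leftAlg, Subalgebra.mem_centralizer_iff]
  rintro _ ⟨c, rfl⟩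
  ext x
  all_goals simp [Bimod.L, Bimod.R, mul_assoc, smul_comm]

theorem R_mem_rightAlg (M : Bimod B) (b : B) : M.R b ∈ M.rightAlg := by
  rw [Bimod.rightAlg, Subalgebra.mem_centralizer_iff]
  rintro _ ⟨c, rfl⟩
  ext x
  all_goals simp [Bimod.L, Bimod.R, mul_assoc, smul_comm]

end Basic

/-! ## The reduced free product with amalgamation over `B` -/

section FreeProduct

variable {B : Type u} [Ring B] [Algebra ℂ B] {K : Type v} (X : K → Bimod B)

/-- An element of one of the bimodules `𝒳°_k`, together with its index `k`. -/
abbrev Elt : Type (max u v) := Σ k : K, (X k).carrier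

/-- The tuples `(x₁, …, x_n)` with `x_i ∈ 𝒳°_{k_i}`, where `w = [k₁, …, k_n]`. -/
abbrev Tuple (w : List K) : Type (max u v) := {l : List (Elt X) // l.map Sigma.fst = w}

/-- The defining relations of `𝒳°_{k₁} ⊗_B ⋯ ⊗_B 𝒳°_{k_n}` in the free vector space on tuples:
additivity and homogeneity in each slot, and `B`-balancedness in neighbouring slots. -/
inductive TensorRel (w : List K) : (Tuple X w →₀ ℂ) → Prop
  | add (s t : List (Elt X)) (k : K) (x y : (X k).carrier)
      (h : ∀ z : (X k).carrier, (s ++ ⟨k, z⟩ :: t).map Sigma.fst = w) :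
      TensorRel w (Finsupp.single ⟨s ++ ⟨k, x + y⟩ :: t, h _⟩ 1
        - (Finsupp.single ⟨s ++ ⟨k, x⟩ :: t, h _⟩ 1 + Finsupp.single ⟨s ++ ⟨k, y⟩ :: t, h _⟩ 1))
  | smul (s t : List (Elt X)) (k : K) (c : ℂ) (x : (X k).carrier)
      (h : ∀ z : (X k).carrier, (s ++ ⟨k, z⟩ :: t).map Sigma.fst = w) :
      TensorRel w (Finsupp.single ⟨s ++ ⟨k, c • x⟩ :: t, h _⟩ 1
        - c • Finsupp.single ⟨s ++ ⟨k, x⟩ :: t, h _⟩ 1)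
  | balanced (s t : List (Elt X)) (j k : K) (b : B) (x : (X j).carrier) (y : (X k).carrier)
      (h : ∀ (z : (X j).carrier) (z' : (X k).carrier),
        (s ++ ⟨j, z⟩ :: ⟨k, z'⟩ :: t).map Sigma.fst = w) :
      TensorRel w (Finsupp.single ⟨s ++ ⟨j, op b • x⟩ :: ⟨k, y⟩ :: t, h _ _⟩ 1
        - Finsupp.single ⟨s ++ ⟨j, x⟩ :: ⟨k, b • y⟩ :: t, h _ _⟩ 1)

/-- The tensor product `𝒳°_{k₁} ⊗_B ⋯ ⊗_B 𝒳°_{k_n}` for a word `w = [k₁, …, k_n]`, `n ≥ 1`. -/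
def WordTensor (w : List K) : Type (max u v) :=
  (Tuple X w →₀ ℂ) ⧸ Submodule.span ℂ {f | TensorRel X w f}

instance (w : List K) : AddCommGroup (WordTensor X w) :=
  inferInstanceAs (AddCommGroup ((Tuple X w →₀ ℂ) ⧸ Submodule.span ℂ {f | TensorRel X w f}))

instance (w : List K) : Module ℂ (WordTensor X w) :=
  inferInstanceAs (Module ℂ ((Tuple X w →₀ ℂ) ⧸ Submodule.span ℂ {f | TensorRel X w f}))

/-- The class `x₁ ⊗ ⋯ ⊗ x_n` of a tuple in `𝒳°_{k₁} ⊗_B ⋯ ⊗_B 𝒳°_{k_n}`, extended linearly. -/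
def WordTensor.mk (w : List K) : (Tuple X w →₀ ℂ) →ₗ[ℂ] WordTensor X w :=
  (Submodule.span ℂ {f | TensorRel X w f}).mkQ

theorem WordTensor.mk_eq {w : List K} {f g : Tuple X w →₀ ℂ} (h : TensorRel X w (f - g)) :
    WordTensor.mk X w f = WordTensor.mk X w g :=
  (Submodule.Quotient.eq _).2 (Submodule.subset_span h)

/-- Nonempty words `k₁ ≠ k₂ ≠ ⋯ ≠ k_n`. -/
abbrev AltWord (K : Type v) : Type v := {w : List K // w ≠ [] ∧ w.IsChain (· ≠ ·)}

/-- The complement `𝒳°` in the reduced free product: the direct sum over all alternating nonempty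
words of `𝒳°_{k₁} ⊗_B ⋯ ⊗_B 𝒳°_{k_n}`. -/
abbrev FreeProdCompl : Type (max u v) := ⨁ w : AltWord K, WordTensor X w.1

/-- The reduced free product `𝒳 = B ⊕ 𝒳°`. -/
abbrev FreeProd : Type (max u v) := B × FreeProdCompl X

open Classical in
/-- The elementary tensor `x₁ ⊗ ⋯ ⊗ x_n ∈ 𝒳` of an alternating list, the empty one being `1_B`
(and the value `0`, never used, at a list whose indices do not alternate). -/
def tensor (l : List (Elt X)) : FreeProd X :=
  if h0 : l = [] then (1, 0)
  else if h : (l.map Sigma.fst).IsChain (· ≠ ·) then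
    (0, DirectSum.lof ℂ (AltWord K) (fun w => WordTensor X w.1)
      ⟨l.map Sigma.fst, by simpa using h0, h⟩ (WordTensor.mk X _ (Finsupp.single ⟨l, rfl⟩ 1)))
  else 0

/-- A function of tuples which is linear in each slot and `B`-balanced. -/
structure IsBalanced {V : Type*} [AddCommGroup V] [Module ℂ V] (f : List (Elt X) → V) : Prop where
  add : ∀ (s t : List (Elt X)) (k : K) (x y : (X k).carrier),
    f (s ++ ⟨k, x + y⟩ :: t) = f (s ++ ⟨k, x⟩ :: t) + f (s ++ ⟨k, y⟩ :: t)
  smul : ∀ (s t : List (Elt X)) (k : K) (c : ℂ) (x : (X k).carrier),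
    f (s ++ ⟨k, c • x⟩ :: t) = c • f (s ++ ⟨k, x⟩ :: t)
  balanced : ∀ (s t : List (Elt X)) (j k : K) (b : B) (x : (X j).carrier) (y : (X k).carrier),
    f (s ++ ⟨j, op b • x⟩ :: ⟨k, y⟩ :: t) = f (s ++ ⟨j, x⟩ :: ⟨k, b • y⟩ :: t)

/-- The linear map on `𝒳°_{k₁} ⊗_B ⋯ ⊗_B 𝒳°_{k_n}` induced by a balanced multilinear function. -/
def WordTensor.lift {V : Type*} [AddCommGroup V] [Module ℂ V] (f : List (Elt X) → V)
    (hf : IsBalanced X f) (w : List K) : WordTensor X w →ₗ[ℂ] V :=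
  Submodule.liftQ _ (Finsupp.linearCombination ℂ fun t : Tuple X w => f t.1) (by
    rw [Submodule.span_le]
    rintro _ (⟨s, t, k, x, y, h⟩ | ⟨s, t, k, c, x, h⟩ | ⟨s, t, j, k, b, x, y, h⟩)
    · simp [hf.add]
    · simp [hf.smul]
    · simp [hf.balanced])

theorem WordTensor.lift_mk {V : Type*} [AddCommGroup V] [Module ℂ V] (f : List (Elt X) → V)
    (hf : IsBalanced X f) (w : List K) (t : Tuple X w) :
    WordTensor.lift X f hf w (WordTensor.mk X w (Finsupp.single t 1)) = f t.1 := by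
  change Finsupp.linearCombination ℂ (fun t : Tuple X w => f t.1) (Finsupp.single t 1) = f t.1
  simp

open Classical in
/-- The linear map on `𝒳°` with prescribed (balanced, multilinear) values on elementary tensors. -/
def liftCompl {V : Type*} [AddCommGroup V] [Module ℂ V] (f : List (Elt X) → V)
    (hf : IsBalanced X f) : FreeProdCompl X →ₗ[ℂ] V :=
  DirectSum.toModule ℂ (AltWord K) V fun w => WordTensor.lift X f hf w.1

/-- The linear map on `𝒳 = B ⊕ 𝒳°` with prescribed values on `B` and on elementary tensors. -/
def liftFree {V : Type*} [AddCommGroup V] [Module ℂ V] (g : B →ₗ[ℂ] V) (f : List (Elt X) → V)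
    (hf : IsBalanced X f) : FreeProd X →ₗ[ℂ] V :=
  g.coprod (liftCompl X f hf)

theorem tensor_nil : tensor X [] = (1, 0) := by simp [tensor]

theorem liftFree_base {V : Type*} [AddCommGroup V] [Module ℂ V] (g : B →ₗ[ℂ] V)
    (f : List (Elt X) → V) (hf : IsBalanced X f) (b : B) : liftFree X g f hf (b, 0) = g b := by
  simp [liftFree]

theorem liftFree_tensor {V : Type*} [AddCommGroup V] [Module ℂ V] (g : B →ₗ[ℂ] V)
    (f : List (Elt X) → V) (hf : IsBalanced X f) (l : List (Elt X)) (h0 : l ≠ [])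
    (h : (l.map Sigma.fst).IsChain (· ≠ ·)) : liftFree X g f hf (tensor X l) = f l := by
  simp only [tensor, dif_neg h0, dif_pos h, liftFree, LinearMap.coprod_apply, map_zero, zero_add,
    liftCompl, DirectSum.toModule_lof, WordTensor.lift_mk]

open Classical in
theorem tensor_of_word (w : List K) (hw : w ≠ [] ∧ w.IsChain (· ≠ ·)) (l : List (Elt X))
    (h : l.map Sigma.fst = w) :
    tensor X l = (0, DirectSum.lof ℂ (AltWord K) (fun w => WordTensor X w.1) ⟨w, hw⟩
      (WordTensor.mk X _ (Finsupp.single ⟨l, h⟩ 1))) := by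
  subst h
  have h0 : l ≠ [] := by simpa using hw.1
  simp only [tensor, dif_neg h0, dif_pos hw.2]

theorem tensor_of_not_alt (l : List (Elt X)) (h : ¬ (l.map Sigma.fst).IsChain (· ≠ ·)) :
    tensor X l = 0 := by
  have h0 : l ≠ [] := by rintro rfl; simp at h
  simp only [tensor, dif_neg h0, dif_neg h]

theorem isBalanced_tensor : IsBalanced X (tensor X) := by
  refine ⟨fun s t k x y => ?_, fun s t k c x => ?_, fun s t j k b x y => ?_⟩
  · have e : ∀ z : (X k).carrier, (s ++ ⟨k, z⟩ :: t).map Sigma.fst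
        = s.map Sigma.fst ++ k :: t.map Sigma.fst := fun z => by simp
    by_cases h : (s.map Sigma.fst ++ k :: t.map Sigma.fst).IsChain (· ≠ ·)
    · have key := WordTensor.mk_eq X (TensorRel.add s t k x y e)
      have hw : (s.map Sigma.fst ++ k :: t.map Sigma.fst) ≠ [] := by simp
      rw [tensor_of_word X _ ⟨hw, h⟩ _ (e _), tensor_of_word X _ ⟨hw, h⟩ _ (e _),
        tensor_of_word X _ ⟨hw, h⟩ _ (e _), key, map_add, map_add]
      simp
    · rw [tensor_of_not_alt, tensor_of_not_alt, tensor_of_not_alt, add_zero] <;> rwa [e]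
  · have e : ∀ z : (X k).carrier, (s ++ ⟨k, z⟩ :: t).map Sigma.fst
        = s.map Sigma.fst ++ k :: t.map Sigma.fst := fun z => by simp
    by_cases h : (s.map Sigma.fst ++ k :: t.map Sigma.fst).IsChain (· ≠ ·)
    · have key := WordTensor.mk_eq X (TensorRel.smul s t k c x e)
      have hw : (s.map Sigma.fst ++ k :: t.map Sigma.fst) ≠ [] := by simp
      rw [tensor_of_word X _ ⟨hw, h⟩ _ (e _), tensor_of_word X _ ⟨hw, h⟩ _ (e _),
        key, map_smul, map_smul]
      simp
    · rw [tensor_of_not_alt, tensor_of_not_alt, smul_zero] <;> rwa [e]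
  · have e : ∀ (z : (X j).carrier) (z' : (X k).carrier),
        (s ++ ⟨j, z⟩ :: ⟨k, z'⟩ :: t).map Sigma.fst
        = s.map Sigma.fst ++ j :: k :: t.map Sigma.fst := fun z z' => by simp
    by_cases h : (s.map Sigma.fst ++ j :: k :: t.map Sigma.fst).IsChain (· ≠ ·)
    · have key := WordTensor.mk_eq X (TensorRel.balanced s t j k b x y e)
      have hw : (s.map Sigma.fst ++ j :: k :: t.map Sigma.fst) ≠ [] := by simp
      rw [tensor_of_word X _ ⟨hw, h⟩ _ (e _ _), tensor_of_word X _ ⟨hw, h⟩ _ (e _ _), key]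
    · rw [tensor_of_not_alt, tensor_of_not_alt] <;> rwa [e]

theorem IsBalanced.comp {V W : Type*} [AddCommGroup V] [Module ℂ V] [AddCommGroup W] [Module ℂ W]
    {f : List (Elt X) → V} (hf : IsBalanced X f) (T : V →ₗ[ℂ] W) :
    IsBalanced X (fun l => T (f l)) :=
  ⟨fun s t k x y => by simp [hf.add], fun s t k c x => by simp [hf.smul],
    fun s t j k b x y => by simp [hf.balanced]⟩

theorem IsBalanced.sum {V : Type*} [AddCommGroup V] [Module ℂ V] {f g : List (Elt X) → V}
    (hf : IsBalanced X f) (hg : IsBalanced X g) : IsBalanced X (fun l => f l + g l) :=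
  ⟨fun s t k x y => by simp only [hf.add, hg.add]; abel,
    fun s t k c x => by simp only [hf.smul, hg.smul, smul_add],
    fun s t j k b x y => by simp only [hf.balanced, hg.balanced]⟩

theorem IsBalanced.consList {V : Type*} [AddCommGroup V] [Module ℂ V] {f : List (Elt X) → V}
    (hf : IsBalanced X f) (e : Elt X) : IsBalanced X (fun l => f (e :: l)) :=
  ⟨fun s t => hf.add (e :: s) t, fun s t => hf.smul (e :: s) t,
    fun s t => hf.balanced (e :: s) t⟩

theorem IsBalanced.snocList {V : Type*} [AddCommGroup V] [Module ℂ V] {f : List (Elt X) → V}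
    (hf : IsBalanced X f) (e : Elt X) : IsBalanced X (fun l => f (l ++ [e])) :=
  ⟨fun s t k x y => by simpa using hf.add s (t ++ [e]) k x y,
    fun s t k c x => by simpa using hf.smul s (t ++ [e]) k c x,
    fun s t j k b x y => by simpa using hf.balanced s (t ++ [e]) j k b x y⟩

/-- `b ⋅ (x₁ ⊗ ⋯ ⊗ x_n) = (b x₁) ⊗ ⋯ ⊗ x_n`. -/
def lmulList (b : B) : List (Elt X) → FreeProd X
  | [] => (b, 0)
  | ⟨k, x⟩ :: t => tensor X (⟨k, b • x⟩ :: t)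

theorem isBalanced_lmulList (b : B) : IsBalanced X (lmulList X b) := by
  have ht := isBalanced_tensor X
  refine ⟨fun s t k x y => ?_, fun s t k c x => ?_, fun s t j k b' x y => ?_⟩
  · rcases s with _ | ⟨⟨i, z⟩, s⟩
    · simpa [lmulList, smul_add] using ht.add [] t k (b • x) (b • y)
    · exact ht.add (⟨i, b • z⟩ :: s) t k x y
  · rcases s with _ | ⟨⟨i, z⟩, s⟩
    · simpa [lmulList, left_smul_complex] using ht.smul [] t k c (b • x)
    · exact ht.smul (⟨i, b • z⟩ :: s) t k c x
  · rcases s with _ | ⟨⟨i, z⟩, s⟩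
    · simpa [lmulList, smul_comm b (op b')] using ht.balanced [] t j k b' (b • x) y
    · exact ht.balanced (⟨i, b • z⟩ :: s) t j k b' x y

/-- `(x₁ ⊗ ⋯ ⊗ x_n) ⋅ b = x₁ ⊗ ⋯ ⊗ (x_n b)`. -/
def rmulList (b : B) (l : List (Elt X)) : FreeProd X :=
  match l.reverse with
  | [] => (b, 0)
  | ⟨k, x⟩ :: t => tensor X (t.reverse ++ [⟨k, op b • x⟩])

theorem rmulList_snoc (b : B) (t : List (Elt X)) (k : K) (x : (X k).carrier) :
    rmulList X b (t ++ [⟨k, x⟩]) = tensor X (t ++ [⟨k, op b • x⟩]) := by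
  simp [rmulList]

theorem isBalanced_rmulList (b : B) : IsBalanced X (rmulList X b) := by
  have ht := isBalanced_tensor X
  refine ⟨fun s t k x y => ?_, fun s t k c x => ?_, fun s t j k b' x y => ?_⟩
  · rcases List.eq_nil_or_concat t with rfl | ⟨t, ⟨i, z⟩, rfl⟩
    · simp only [rmulList_snoc, smul_add]
      exact ht.add s [] k (op b • x) (op b • y)
    · simp only [List.concat_eq_append, ← List.cons_append, ← List.append_assoc, rmulList_snoc]
      simpa using ht.add s (t ++ [⟨i, op b • z⟩]) k x y
  · rcases List.eq_nil_or_concat t with rfl | ⟨t, ⟨i, z⟩, rfl⟩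
    · simp only [rmulList_snoc, right_smul_complex]
      exact ht.smul s [] k c (op b • x)
    · simp only [List.concat_eq_append, ← List.cons_append, ← List.append_assoc, rmulList_snoc]
      simpa using ht.smul s (t ++ [⟨i, op b • z⟩]) k c x
  · rcases List.eq_nil_or_concat t with rfl | ⟨t, ⟨i, z⟩, rfl⟩
    · have h1 := rmulList_snoc X b (s ++ [⟨j, op b' • x⟩]) k y
      have h2 := rmulList_snoc X b (s ++ [⟨j, x⟩]) k (b' • y)
      simp only [List.append_assoc, List.cons_append, List.nil_append] at h1 h2
      rw [h1, h2, ← smul_comm b' (op b) y]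
      exact ht.balanced s [] j k b' x (op b • y)
    · simp only [List.concat_eq_append, ← List.cons_append, ← List.append_assoc, rmulList_snoc]
      simpa using ht.balanced s (t ++ [⟨i, op b • z⟩]) j k b' x y

theorem lmulList_add (b c : B) (l : List (Elt X)) :
    lmulList X (b + c) l = lmulList X b l + lmulList X c l := by
  rcases l with _ | ⟨⟨k, x⟩, t⟩
  · simp [lmulList]
  · simpa [lmulList, add_smul] using (isBalanced_tensor X).add [] t k (b • x) (c • x)

theorem lmulList_smul (c : ℂ) (b : B) (l : List (Elt X)) :
    lmulList X (c • b) l = c • lmulList X b l := by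
  rcases l with _ | ⟨⟨k, x⟩, t⟩
  · simp [lmulList]
  · simpa [lmulList, smul_assoc] using (isBalanced_tensor X).smul [] t k c (b • x)

theorem rmulList_add (b c : B) (l : List (Elt X)) :
    rmulList X (b + c) l = rmulList X b l + rmulList X c l := by
  rcases List.eq_nil_or_concat l with rfl | ⟨t, ⟨k, x⟩, rfl⟩
  · simp [rmulList]
  · simpa [rmulList_snoc, add_smul] using
      (isBalanced_tensor X).add t [] k (op b • x) (op c • x)

theorem rmulList_smul (c : ℂ) (b : B) (l : List (Elt X)) :
    rmulList X (c • b) l = c • rmulList X b l := by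
  rcases List.eq_nil_or_concat l with rfl | ⟨t, ⟨k, x⟩, rfl⟩
  · simp [rmulList]
  · simpa [rmulList_snoc, smul_assoc] using
      (isBalanced_tensor X).smul t [] k c (op b • x)

/-- The isomorphism `V_k⁻¹ : 𝒳_k ⊗_B 𝒳_ℓ(k) → 𝒳` at `ξ ⊗ (x₁ ⊗ ⋯ ⊗ x_n)`, `ξ = β ⊕ x`:
it is `β x₁ ⊗ ⋯ ⊗ x_n + x ⊗ x₁ ⊗ ⋯ ⊗ x_n`. -/
def joinLeft (k : K) (l : List (Elt X)) : (X k).Total →ₗ[ℂ] FreeProd X where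
  toFun ξ := lmulList X ξ.1 l + tensor X (⟨k, ξ.2⟩ :: l)
  map_add' ξ η := by
    have := (isBalanced_tensor X).add [] l k ξ.2 η.2
    simp only [List.nil_append] at this
    simp only [Prod.fst_add, Prod.snd_add, lmulList_add, this]
    abel
  map_smul' c ξ := by
    have := (isBalanced_tensor X).smul [] l k c ξ.2
    simp only [List.nil_append] at this
    simp only [Prod.smul_fst, Prod.smul_snd, lmulList_smul, this, smul_add, RingHom.id_apply]

/-- The isomorphism `W_k⁻¹ : 𝒳_r(k) ⊗_B 𝒳_k → 𝒳` at `(x₁ ⊗ ⋯ ⊗ x_n) ⊗ ξ`, `ξ = β ⊕ x`: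
it is `x₁ ⊗ ⋯ ⊗ x_n β + x₁ ⊗ ⋯ ⊗ x_n ⊗ x`. -/
def joinRight (k : K) (l : List (Elt X)) : (X k).Total →ₗ[ℂ] FreeProd X where
  toFun ξ := rmulList X ξ.1 l + tensor X (l ++ [⟨k, ξ.2⟩])
  map_add' ξ η := by
    have := (isBalanced_tensor X).add l [] k ξ.2 η.2
    simp only [Prod.fst_add, Prod.snd_add, rmulList_add, this]
    abel
  map_smul' c ξ := by
    have := (isBalanced_tensor X).smul l [] k c ξ.2
    simp only [Prod.smul_fst, Prod.smul_snd, rmulList_smul, this, smul_add, RingHom.id_apply]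

theorem isBalanced_joinLeft (k : K) (ξ : (X k).Total) :
    IsBalanced X (fun l => joinLeft X k l ξ) :=
  (isBalanced_lmulList X ξ.1).sum X ((isBalanced_tensor X).consList X ⟨k, ξ.2⟩)

theorem isBalanced_joinRight (k : K) (ξ : (X k).Total) :
    IsBalanced X (fun l => joinRight X k l ξ) :=
  (isBalanced_rmulList X ξ.1).sum X ((isBalanced_tensor X).snocList X ⟨k, ξ.2⟩)

theorem joinLeft_balanced (k i : K) (ξ : (X k).Total) (b : B) (y : (X i).carrier)
    (t : List (Elt X)) :
    joinLeft X k (⟨i, y⟩ :: t) (op b • ξ) = joinLeft X k (⟨i, b • y⟩ :: t) ξ := by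
  have := (isBalanced_tensor X).balanced [] t k i b ξ.2 y
  simp only [List.nil_append] at this
  simp [joinLeft, lmulList, this, mul_smul]

theorem joinRight_balanced (k i : K) (ξ : (X k).Total) (b : B) (y : (X i).carrier)
    (t : List (Elt X)) :
    joinRight X k (t ++ [⟨i, op b • y⟩]) ξ = joinRight X k (t ++ [⟨i, y⟩]) (b • ξ) := by
  have := (isBalanced_tensor X).balanced t [] i k b y ξ.2
  simp [joinRight, rmulList_snoc, this, mul_smul]

open Classical in
/-- `V_k⁻¹ (a ⊗ Id) V_k` on elementary tensors: `V_k (x₁ ⊗ ⋯ ⊗ x_n)` is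
`(0 ⊕ x₁) ⊗ (x₂ ⊗ ⋯ ⊗ x_n)` if `x₁ ∈ 𝒳°_k`, and `(1_B ⊕ 0) ⊗ (x₁ ⊗ ⋯ ⊗ x_n)` otherwise. -/
def lambdaList (k : K) (a : (X k).Op) : List (Elt X) → FreeProd X
  | [] => joinLeft X k [] (a (1, 0))
  | ⟨j, x⟩ :: t =>
    if h : j = k then joinLeft X k t (a (0, h ▸ x))
    else joinLeft X k (⟨j, x⟩ :: t) (a (1, 0))

open Classical in
/-- `W_k⁻¹ (Id ⊗ a) W_k` on elementary tensors: `W_k (x₁ ⊗ ⋯ ⊗ x_n)` is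
`(x₁ ⊗ ⋯ ⊗ x_{n-1}) ⊗ (0 ⊕ x_n)` if `x_n ∈ 𝒳°_k`, and `(x₁ ⊗ ⋯ ⊗ x_n) ⊗ (1_B ⊕ 0)` otherwise. -/
def rhoList (k : K) (a : (X k).Op) (l : List (Elt X)) : FreeProd X :=
  match l.reverse with
  | [] => joinRight X k [] (a (1, 0))
  | ⟨j, x⟩ :: t =>
    if h : j = k then joinRight X k t.reverse (a (0, h ▸ x))
    else joinRight X k (t.reverse ++ [⟨j, x⟩]) (a (1, 0))

theorem lambdaList_self (k : K) (a : (X k).Op) (x : (X k).carrier) (t : List (Elt X)) :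
    lambdaList X k a (⟨k, x⟩ :: t) = joinLeft X k t (a (0, x)) := by
  simp [lambdaList]

theorem lambdaList_ne (k j : K) (a : (X k).Op) (x : (X j).carrier) (t : List (Elt X))
    (h : j ≠ k) :
    lambdaList X k a (⟨j, x⟩ :: t) = joinLeft X k (⟨j, x⟩ :: t) (a (1, 0)) := by
  simp [lambdaList, h]

theorem rhoList_self (k : K) (a : (X k).Op) (x : (X k).carrier) (t : List (Elt X)) :
    rhoList X k a (t ++ [⟨k, x⟩]) = joinRight X k t (a (0, x)) := by
  simp [rhoList]

theorem rhoList_ne (k j : K) (a : (X k).Op) (x : (X j).carrier) (t : List (Elt X))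
    (h : j ≠ k) :
    rhoList X k a (t ++ [⟨j, x⟩]) = joinRight X k (t ++ [⟨j, x⟩]) (a (1, 0)) := by
  simp [rhoList, h]

theorem isBalanced_lambdaList (k : K) (a : (X k).leftAlg) :
    IsBalanced X (lambdaList X k a.1) := by
  refine ⟨fun s t i x y => ?_, fun s t i c x => ?_, fun s t j i b x y => ?_⟩
  · rcases s with _ | ⟨⟨j, z⟩, s⟩
    · by_cases h : i = k
      · subst h
        simp only [List.nil_append, lambdaList_self, ← map_add, Prod.mk_add_mk, add_zero]
      · simp only [List.nil_append, lambdaList_ne X k i _ _ _ h]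
        exact (isBalanced_joinLeft X k _).add [] t i x y
    · by_cases h : j = k
      · subst h
        simp only [List.cons_append, lambdaList_self]
        exact (isBalanced_joinLeft X j _).add s t i x y
      · simp only [List.cons_append, lambdaList_ne X k j _ _ _ h]
        exact (isBalanced_joinLeft X k _).add (⟨j, z⟩ :: s) t i x y
  · rcases s with _ | ⟨⟨j, z⟩, s⟩
    · by_cases h : i = k
      · subst h
        simp only [List.nil_append, lambdaList_self, ← map_smul, Prod.smul_mk, smul_zero]
      · simp only [List.nil_append, lambdaList_ne X k i _ _ _ h]
        exact (isBalanced_joinLeft X k _).smul [] t i c x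
    · by_cases h : j = k
      · subst h
        simp only [List.cons_append, lambdaList_self]
        exact (isBalanced_joinLeft X j _).smul s t i c x
      · simp only [List.cons_append, lambdaList_ne X k j _ _ _ h]
        exact (isBalanced_joinLeft X k _).smul (⟨j, z⟩ :: s) t i c x
  · rcases s with _ | ⟨⟨m, z⟩, s⟩
    · by_cases h : j = k
      · subst h
        have e : ((0, op b • x) : (X j).Total) = op b • (0, x) := by simp
        simp only [List.nil_append, lambdaList_self]
        rw [e, leftAlg_apply, joinLeft_balanced]
      · simp only [List.nil_append, lambdaList_ne X k j _ _ _ h]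
        exact (isBalanced_joinLeft X k _).balanced [] t j i b x y
    · by_cases h : m = k
      · subst h
        simp only [List.cons_append, lambdaList_self]
        exact (isBalanced_joinLeft X m _).balanced s t j i b x y
      · simp only [List.cons_append, lambdaList_ne X k m _ _ _ h]
        exact (isBalanced_joinLeft X k _).balanced (⟨m, z⟩ :: s) t j i b x y

theorem isBalanced_rhoList (k : K) (a : (X k).rightAlg) :
    IsBalanced X (rhoList X k a.1) := by
  refine ⟨fun s t i x y => ?_, fun s t i c x => ?_, fun s t j i b x y => ?_⟩
  · rcases List.eq_nil_or_concat t with rfl | ⟨t, ⟨j, z⟩, rfl⟩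
    · by_cases h : i = k
      · subst h
        simp only [rhoList_self, ← map_add, Prod.mk_add_mk, add_zero]
      · simp only [rhoList_ne X k i _ _ _ h]
        exact (isBalanced_joinRight X k _).add s [] i x y
    · simp only [List.concat_eq_append, ← List.cons_append, ← List.append_assoc]
      by_cases h : j = k
      · subst h
        simp only [rhoList_self]
        exact (isBalanced_joinRight X j _).add s t i x y
      · simp only [rhoList_ne X k j _ _ _ h]
        simpa using (isBalanced_joinRight X k _).add s (t ++ [⟨j, z⟩]) i x y
  · rcases List.eq_nil_or_concat t with rfl | ⟨t, ⟨j, z⟩, rfl⟩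
    · by_cases h : i = k
      · subst h
        simp only [rhoList_self, ← map_smul, Prod.smul_mk, smul_zero]
      · simp only [rhoList_ne X k i _ _ _ h]
        exact (isBalanced_joinRight X k _).smul s [] i c x
    · simp only [List.concat_eq_append, ← List.cons_append, ← List.append_assoc]
      by_cases h : j = k
      · subst h
        simp only [rhoList_self]
        exact (isBalanced_joinRight X j _).smul s t i c x
      · simp only [rhoList_ne X k j _ _ _ h]
        simpa using (isBalanced_joinRight X k _).smul s (t ++ [⟨j, z⟩]) i c x
  · rcases List.eq_nil_or_concat t with rfl | ⟨t, ⟨m, z⟩, rfl⟩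
    · have e1 : ∀ (u : (X j).carrier) (w : (X i).carrier),
          s ++ [⟨j, u⟩, ⟨i, w⟩] = (s ++ [⟨j, u⟩]) ++ [(⟨i, w⟩ : Elt X)] := by simp
      rw [e1, e1]
      by_cases h : i = k
      · subst h
        have e : ((0, b • y) : (X i).Total) = b • (0, y) := by simp
        simp only [rhoList_self]
        rw [e, rightAlg_apply, joinRight_balanced]
      · rw [rhoList_ne X k i _ _ _ h, rhoList_ne X k i _ _ _ h, ← e1, ← e1]
        exact (isBalanced_joinRight X k _).balanced s [] j i b x y
    · simp only [List.concat_eq_append, ← List.cons_append, ← List.append_assoc]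
      by_cases h : m = k
      · subst h
        simp only [rhoList_self]
        exact (isBalanced_joinRight X m _).balanced s t j i b x y
      · simp only [rhoList_ne X k m _ _ _ h]
        simpa using (isBalanced_joinRight X k _).balanced s (t ++ [⟨m, z⟩]) j i b x y

/-- The left regular representation `λ_k(a) = V_k⁻¹ (a ⊗ Id) V_k`; the operator `a ⊗ Id` on
`𝒳_k ⊗_B 𝒳_ℓ(k)` makes sense for `a ∈ ℒ_ℓ(𝒳_k)`. -/
def lambda (k : K) (a : (X k).leftAlg) : Module.End ℂ (FreeProd X) :=
  liftFree X (joinLeft X k [] ∘ₗ a.1 ∘ₗ LinearMap.inl ℂ B (X k).carrier) (lambdaList X k a.1)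
    (isBalanced_lambdaList X k a)

/-- The right regular representation `ρ_k(a) = W_k⁻¹ (Id ⊗ a) W_k`; the operator `Id ⊗ a` on
`𝒳_r(k) ⊗_B 𝒳_k` makes sense for `a ∈ ℒ_r(𝒳_k)`. -/
def rho (k : K) (a : (X k).rightAlg) : Module.End ℂ (FreeProd X) :=
  liftFree X (joinRight X k [] ∘ₗ a.1 ∘ₗ LinearMap.inl ℂ B (X k).carrier) (rhoList X k a.1)
    (isBalanced_rhoList X k a)

/-- The inclusion of `𝒳_k = B ⊕ 𝒳°_k` in the reduced free product. -/
def incl (k : K) : (X k).Total →ₗ[ℂ] FreeProd X := joinLeft X k []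

open Classical in
/-- The coordinate in `𝒳°_k` of an elementary tensor (zero unless it has the one factor `k`). -/
def projList (k : K) : List (Elt X) → (X k).Total
  | [⟨j, x⟩] => if h : j = k then (0, h ▸ x) else 0
  | _ => 0

theorem isBalanced_projList (k : K) : IsBalanced X (projList X k) := by
  refine ⟨fun s t i x y => ?_, fun s t i c x => ?_, fun s t j i b x y => ?_⟩
  · rcases s with _ | ⟨e, _ | ⟨e', s⟩⟩ <;> rcases t with _ | ⟨f, t⟩ <;> simp [projList]
    by_cases h : i = k
    · subst h; simp
    · simp [h]
  · rcases s with _ | ⟨e, _ | ⟨e', s⟩⟩ <;> rcases t with _ | ⟨f, t⟩ <;> simp [projList]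
    by_cases h : i = k
    · subst h; simp
    · simp [h]
  · rcases s with _ | ⟨e, _ | ⟨e', s⟩⟩ <;> simp [projList]

/-- The map `𝒳 → 𝒳_k = B ⊕ 𝒳°_k` which forgets all the other direct summands of `𝒳`. -/
def proj (k : K) : FreeProd X →ₗ[ℂ] (X k).Total :=
  liftFree X (LinearMap.inl ℂ B (X k).carrier) (projList X k) (isBalanced_projList X k)

/-- The `k`-th Boolean projection `P_k`, the natural projection of `𝒳` onto `B ⊕ 𝒳°_k`. -/
def boolProj (k : K) : Module.End ℂ (FreeProd X) := incl X k ∘ₗ proj X k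

/-- The operator `P_k λ_k(T) P_k`. As `λ_k(T)` acts on `B ⊕ 𝒳°_k = 𝒳_k` by `T`, it makes sense for
every `T ∈ ℒ(𝒳_k)`, and it is the composite `𝒳 → 𝒳_k → 𝒳_k → 𝒳` with `T` in the middle
(see `boolAct_eq` for `T ∈ ℒ_ℓ(𝒳_k)`). -/
def boolAct (k : K) (T : (X k).Op) : Module.End ℂ (FreeProd X) :=
  incl X k ∘ₗ T ∘ₗ proj X k

theorem proj_incl (k : K) (ξ : (X k).Total) : proj X k (incl X k ξ) = ξ := by
  have h1 : proj X k (tensor X [⟨k, ξ.2⟩]) = (0, ξ.2) := by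
    rw [proj, liftFree_tensor _ _ _ _ _ (by simp) (by simp)]; simp [projList]
  have h2 : proj X k (ξ.1, 0) = (ξ.1, 0) := by rw [proj, liftFree_base]; rfl
  change proj X k (lmulList X ξ.1 [] + tensor X [⟨k, ξ.2⟩]) = ξ
  rw [map_add, h1, lmulList, h2]
  simp

theorem lambda_incl (k : K) (a : (X k).leftAlg) (ξ : (X k).Total) :
    lambda X k a (incl X k ξ) = incl X k (a.1 ξ) := by
  have h1 : lambda X k a (tensor X [⟨k, ξ.2⟩]) = incl X k (a.1 (0, ξ.2)) := by
    rw [lambda, liftFree_tensor _ _ _ _ _ (by simp) (by simp), lambdaList_self]; rfl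
  have h2 : lambda X k a (ξ.1, 0) = incl X k (a.1 (ξ.1, 0)) := by
    rw [lambda, liftFree_base]; rfl
  change lambda X k a (lmulList X ξ.1 [] + tensor X [⟨k, ξ.2⟩]) = _
  rw [map_add, h1, lmulList, h2, ← map_add, ← map_add]
  simp

theorem boolAct_eq (k : K) (a : (X k).leftAlg) :
    boolAct X k a.1 = boolProj X k * lambda X k a * boolProj X k := by
  refine LinearMap.ext fun η => ?_
  simp [boolAct, boolProj, lambda_incl, proj_incl]

end FreeProduct

/-! ## `B`-`B`-non-commutative probability spaces and triples of `B`-faces -/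

section Spaces

variable (B 𝒜 : Type u) [Ring B] [Algebra ℂ B] [Ring 𝒜] [Algebra ℂ 𝒜]

/-- A `B`-`B`-non-commutative probability space `(𝒜, E, ε)`. -/
structure BBSpace where
  ε : B ⊗[ℂ] Bᵐᵒᵖ →ₐ[ℂ] 𝒜
  ε_left_injective : Function.Injective fun b : B => ε (b ⊗ₜ[ℂ] 1)
  ε_right_injective : Function.Injective fun b : B => ε (1 ⊗ₜ[ℂ] op b)
  E : 𝒜 →ₗ[ℂ] B
  E_bimodule : ∀ (b₁ b₂ : B) (T : 𝒜), E (ε (b₁ ⊗ₜ[ℂ] op b₂) * T) = b₁ * E T * b₂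
  E_balanced : ∀ (b : B) (T : 𝒜), E (T * ε (b ⊗ₜ[ℂ] 1)) = E (T * ε (1 ⊗ₜ[ℂ] op b))

end Spaces

section Faces

variable {B 𝒜 : Type u} [Ring B] [Algebra ℂ B] [Ring 𝒜] [Algebra ℂ 𝒜]

/-- `L_b = ε (b ⊗ 1)`. -/
def BBSpace.L (S : BBSpace B 𝒜) (b : B) : 𝒜 := S.ε (b ⊗ₜ[ℂ] 1)

/-- `R_b = ε (1 ⊗ b)`. -/
def BBSpace.R (S : BBSpace B 𝒜) (b : B) : 𝒜 := S.ε (1 ⊗ₜ[ℂ] op b)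

/-- The left algebra `𝒜_ℓ`, the commutant of all `R_b`. -/
def BBSpace.leftAlg (S : BBSpace B 𝒜) : Subalgebra ℂ 𝒜 :=
  Subalgebra.centralizer ℂ (Set.range S.R)

/-- The right algebra `𝒜_r`, the commutant of all `L_b`. -/
def BBSpace.rightAlg (S : BBSpace B 𝒜) : Subalgebra ℂ 𝒜 :=
  Subalgebra.centralizer ℂ (Set.range S.L)

/-- A triple of `B`-faces `(A^ℓ, A^r, A^b)`; the third algebra need not be unital. -/
structure FaceTriple (S : BBSpace B 𝒜) where
  left : Subalgebra ℂ 𝒜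
  right : Subalgebra ℂ 𝒜
  bool : NonUnitalSubalgebra ℂ 𝒜
  L_mem : ∀ b, S.L b ∈ left
  left_le : left ≤ S.leftAlg
  R_mem : ∀ b, S.R b ∈ right
  right_le : right ≤ S.rightAlg
  bool_stable : ∀ (b₁ b₂ : B), ∀ d ∈ bool, S.L b₁ * d * S.L b₂ ∈ bool
  bool_le : ∀ d ∈ bool, d ∈ S.leftAlg

/-- A letter from a triple of faces: an element of one of its three algebras, together with the
information which of the three it is taken from. -/
inductive Letter {S : BBSpace B 𝒜} (A : FaceTriple S) : Type u
  | left (z : A.left)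
  | right (z : A.right)
  | bool (z : A.bool)

/-- The element of `𝒜` which a letter stands for. -/
def Letter.val {S : BBSpace B 𝒜} {A : FaceTriple S} : Letter A → 𝒜
  | .left z => z
  | .right z => z
  | .bool z => z

/-- The joint distribution of one triple of faces, given by its moments `E (Z₁ ⋯ Z_n)`. -/
def FaceTriple.dist {S : BBSpace B 𝒜} (A : FaceTriple S) (w : List (Letter A)) : B :=
  S.E (w.map Letter.val).prod

/-- The joint distribution `μ_Γ` of a family of triples of faces, given by its moments
`E (Z₁ ⋯ Z_n)`, where the `Z_i` come from the triples of arbitrary (varying) indices. -/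
def jointDist {S : BBSpace B 𝒜} {K : Type v} (Γ : K → FaceTriple S)
    (w : List (Σ k, Letter (Γ k))) : B :=
  S.E (w.map fun Z => Z.2.val).prod

/-- A representation of a triple of faces on a bimodule with specified projection: unital
homomorphisms into `ℒ_ℓ(𝒳)` and `ℒ_r(𝒳)` which respect the copies of `B`, and a not necessarily
unital homomorphism into `ℒ(𝒳)`. -/
structure FaceRep {S : BBSpace B 𝒜} (A : FaceTriple S) (M : Bimod B) where
  ℓ : A.left →ₐ[ℂ] M.leftAlg
  r : A.right →ₐ[ℂ] M.rightAlg
  m : A.bool →ₙₐ[ℂ] M.Op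
  ℓ_L : ∀ b, (ℓ ⟨S.L b, A.L_mem b⟩ : M.Op) = M.L b
  r_R : ∀ b, (r ⟨S.R b, A.R_mem b⟩ : M.Op) = M.R b

/-- The operator on `𝒳` by which a letter acts in a representation. -/
def FaceRep.act {S : BBSpace B 𝒜} {A : FaceTriple S} {M : Bimod B} (ρ : FaceRep A M) :
    Letter A → M.Op
  | .left z => (ρ.ℓ z).1
  | .right z => (ρ.r z).1
  | .bool z => ρ.m z

/-- The joint distribution of the image `(ℓ(A^ℓ), r(A^r), m(A^b))` of a triple, in `ℒ(𝒳)`. -/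
def FaceRep.dist {S : BBSpace B 𝒜} {A : FaceTriple S} {M : Bimod B} (ρ : FaceRep A M)
    (w : List (Letter A)) : B :=
  vacuumExp (w.map ρ.act).prod

/-- The operator on the reduced free product by which a letter of the `k`-th triple acts:
`λ_k(ℓ_k(z))`, `ρ_k(r_k(z))` or `P_k λ_k(m_k(z)) P_k`. -/
def freeAct {S : BBSpace B 𝒜} {K : Type v} {Γ : K → FaceTriple S} {X : K → Bimod B}
    (ρ : ∀ k, FaceRep (Γ k) (X k)) : (Σ k, Letter (Γ k)) → Module.End ℂ (FreeProd X)
  | ⟨k, .left z⟩ => lambda X k ((ρ k).ℓ z)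
  | ⟨k, .right z⟩ => rho X k ((ρ k).r z)
  | ⟨k, .bool z⟩ => boolAct X k ((ρ k).m z)

/-- The joint distribution, in `(ℒ(𝒳), E)` with `𝒳` the reduced free product, of the family
`{(λ_k(ℓ_k(A^ℓ_k)), ρ_k(r_k(A^r_k)), P_k λ_k(m_k(A^b_k)) P_k)}`. -/
def freeDist {S : BBSpace B 𝒜} {K : Type v} {Γ : K → FaceTriple S} {X : K → Bimod B}
    (ρ : ∀ k, FaceRep (Γ k) (X k)) (w : List (Σ k, Letter (Γ k))) : B :=
  vacuumExp (w.map (freeAct ρ)).prod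

/-- The family `Γ` is free-free-Boolean independent over `B` by means of the representations `ρ`:
its joint distribution is the one of the represented family on the reduced free product. -/
def IsFFBVia {S : BBSpace B 𝒜} {K : Type v} (Γ : K → FaceTriple S) {X : K → Bimod B}
    (ρ : ∀ k, FaceRep (Γ k) (X k)) : Prop :=
  jointDist Γ = freeDist ρ

/-- The family `Γ` is free-free-Boolean independent with amalgamation over `B`. -/
def IsFFB {S : BBSpace B 𝒜} {K : Type v} (Γ : K → FaceTriple S) : Prop :=
  ∃ (X : K → Bimod B) (ρ : ∀ k, FaceRep (Γ k) (X k)), IsFFBVia Γ ρ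

end Faces

section Images

variable {B 𝒜 𝒜' : Type u} [Ring B] [Algebra ℂ B] [Ring 𝒜] [Algebra ℂ 𝒜] [Ring 𝒜'] [Algebra ℂ 𝒜']

/-- Homomorphisms of the three algebras of a triple of faces onto those of another triple of faces
(possibly of another space over `B`), respecting the copies of `B`. -/
structure FaceImage {S : BBSpace B 𝒜} (A : FaceTriple S) {S' : BBSpace B 𝒜'} (A' : FaceTriple S')
    where
  left : A.left →ₐ[ℂ] A'.left
  right : A.right →ₐ[ℂ] A'.right
  bool : A.bool →ₙₐ[ℂ] A'.bool
  left_surjective : Function.Surjective left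
  right_surjective : Function.Surjective right
  bool_surjective : Function.Surjective bool
  left_L : ∀ b, (left ⟨S.L b, A.L_mem b⟩ : 𝒜') = S'.L b
  right_R : ∀ b, (right ⟨S.R b, A.R_mem b⟩ : 𝒜') = S'.R b

/-- The image of a letter. -/
def FaceImage.map {S : BBSpace B 𝒜} {A : FaceTriple S} {S' : BBSpace B 𝒜'} {A' : FaceTriple S'}
    (φ : FaceImage A A') : Letter A → Letter A'
  | .left z => .left (φ.left z)
  | .right z => .right (φ.right z)
  | .bool z => .bool (φ.bool z)

end Images

end FFB

end

open FFB

/-!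
The mathematical core is that the joint distribution of the represented family on the reduced free
product depends only on the joint distributions of the single representations. If two
representations of a triple on `𝒳_k` and `𝒴_k` have the same joint distribution, the pairs
`(T 1, T' 1)`, for corresponding polynomials `T`, `T'` in the representing operators, span a linear
relation between `𝒳_k` and `𝒴_k` which is preserved by all these operators and on which the two
projections to `B` agree. Elementary tensors of related vectors then span a relation between the two
reduced free products with the same properties, and it contains the pair of vacuum vectors.

Conversely, the represented family restricts on `𝒳_k = B ⊕ 𝒳°_k` to the `k`-th representation, so
independence via some representations forces these to have the right single distributions; hence
they may be exchanged for any others with this property. To pass independence from a family to its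
image one needs such representations of the image: `𝒜` acts on the cyclic module
`𝒜 / ∑_b 𝒜 (L_b - R_b)`, which is the direct sum of `B` and the kernel of `E` if `E 1 = 1`, and this
action restricts to the faces.
-/

noncomputable section

namespace FFB

/-! ## Relations between bimodules and between reduced free products -/

section Relations

variable {B : Type u} [Ring B] [Algebra ℂ B]

/-- A linear relation between two bimodules with specified projection is a bimodule relation if it
contains the pair of vacuum vectors, is stable under both actions of `B`, and relates only vectors
with the same projection to `B`. -/
structure IsBimodRel {M N : Bimod B} (R : Submodule ℂ (M.Total × N.Total)) : Prop where
  vacuum_mem : ((1, 0), (1, 0)) ∈ R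
  smul_mem : ∀ b : B, ∀ q ∈ R, b • q ∈ R
  op_smul_mem : ∀ b : B, ∀ q ∈ R, op b • q ∈ R
  fst_eq : ∀ q ∈ R, q.1.1 = q.2.1

theorem IsBimodRel.base_mem {M N : Bimod B} {R : Submodule ℂ (M.Total × N.Total)}
    (hR : IsBimodRel R) (b : B) : ((b, 0), (b, 0)) ∈ R := by
  simpa using hR.smul_mem b _ hR.vacuum_mem

theorem IsBimodRel.compl_mem {M N : Bimod B} {R : Submodule ℂ (M.Total × N.Total)}
    (hR : IsBimodRel R) {q : M.Total × N.Total} (hq : q ∈ R) : ((0, q.1.2), (0, q.2.2)) ∈ R := by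
  have h_sub : q - ((q.1.1, 0), (q.1.1, 0)) = ((0, q.1.2), (0, q.2.2)) := by
    ext <;> simp [hR.fst_eq q hq]
  exact h_sub ▸ R.sub_mem hq (hR.base_mem q.1.1)

variable {K : Type v} {X Y : K → Bimod B} (R : ∀ k, Submodule ℂ ((X k).Total × (Y k).Total))

/-- A pair of related vectors in the complements `𝒳°_k` and `𝒴°_k`, together with the index `k`. -/
structure RelElt where
  idx : K
  fst : (X idx).carrier
  snd : (Y idx).carrier
  mem : ((0, fst), (0, snd)) ∈ R idx

variable {R}

/-- The first vector of a related pair, as a tensor factor. -/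
def RelElt.left (e : RelElt R) : Elt X := ⟨e.idx, e.fst⟩

/-- The second vector of a related pair, as a tensor factor. -/
def RelElt.right (e : RelElt R) : Elt Y := ⟨e.idx, e.snd⟩

theorem RelElt.map_fst_left_eq_right (P : List (RelElt R)) :
    (P.map RelElt.left).map Sigma.fst = (P.map RelElt.right).map Sigma.fst := by
  simp [Function.comp_def, RelElt.left, RelElt.right]

variable (R)

/-- The relation between two reduced free products induced by relations between their factors: it is
spanned by the pairs `(b, b)` with `b ∈ B` and by the pairs of elementary tensors with related
factors. -/
def freeRel : Submodule ℂ (FreeProd X × FreeProd Y) :=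
  Submodule.span ℂ (Set.range (fun b : B => ((b, 0), (b, 0))) ∪
    Set.range fun P : List (RelElt R) =>
      (tensor X (P.map RelElt.left), tensor Y (P.map RelElt.right)))

variable {R}

theorem base_mem_freeRel (b : B) : ((b, 0), (b, 0)) ∈ freeRel R :=
  Submodule.subset_span (Or.inl ⟨b, rfl⟩)

theorem tensor_mem_freeRel (P : List (RelElt R)) :
    (tensor X (P.map RelElt.left), tensor Y (P.map RelElt.right)) ∈ freeRel R :=
  Submodule.subset_span (Or.inr ⟨P, rfl⟩)

theorem freeRel_le {U : Submodule ℂ (FreeProd X × FreeProd Y)}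
    (h_base : ∀ b : B, ((b, 0), (b, 0)) ∈ U)
    (h_tensor : ∀ P : List (RelElt R), P ≠ [] →
      ((P.map RelElt.left).map Sigma.fst).IsChain (· ≠ ·) →
      (tensor X (P.map RelElt.left), tensor Y (P.map RelElt.right)) ∈ U) :
    freeRel R ≤ U := by
  refine Submodule.span_le.2 ?_
  rintro _ (⟨b, rfl⟩ | ⟨P, rfl⟩)
  · exact h_base b
  · rcases eq_or_ne P [] with rfl | hP
    · simpa only [List.map_nil, tensor_nil, SetLike.mem_coe] using h_base 1
    · by_cases h_alt : ((P.map RelElt.left).map Sigma.fst).IsChain (· ≠ ·)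
      · exact h_tensor P hP h_alt
      · simp only [tensor_of_not_alt _ _ h_alt,
          tensor_of_not_alt _ _ (RelElt.map_fst_left_eq_right P ▸ h_alt)]
        exact U.zero_mem

theorem tensor_fst (X : K → Bimod B) {l : List (Elt X)} (hl : l ≠ []) : (tensor X l).1 = 0 := by
  rw [tensor, dif_neg hl]
  split <;> rfl

theorem fst_eq_of_mem_freeRel {q : FreeProd X × FreeProd Y} (hq : q ∈ freeRel R) :
    q.1.1 = q.2.1 := by
  have h_le : freeRel R ≤ LinearMap.eqLocus (LinearMap.fst ℂ B _ ∘ₗ LinearMap.fst ℂ _ _)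
      (LinearMap.fst ℂ B _ ∘ₗ LinearMap.snd ℂ _ _) :=
    freeRel_le (fun _ => rfl) fun P hP _ => by simp [tensor_fst, hP]
  exact h_le hq

theorem liftFree_mapsTo_freeRel {V W : Type*} [AddCommGroup V] [Module ℂ V] [AddCommGroup W]
    [Module ℂ W] {U : Submodule ℂ (V × W)} {g : B →ₗ[ℂ] V} {g' : B →ₗ[ℂ] W}
    {f : List (Elt X) → V} {f' : List (Elt Y) → W} (hf : IsBalanced X f) (hf' : IsBalanced Y f')
    (h_base : ∀ b, (g b, g' b) ∈ U)
    (h_list : ∀ P : List (RelElt R), P ≠ [] →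
      (f (P.map RelElt.left), f' (P.map RelElt.right)) ∈ U) :
    Set.MapsTo (Prod.map (liftFree X g f hf) (liftFree Y g' f' hf')) (freeRel R) U := by
  suffices h_le : freeRel R ≤ U.comap ((liftFree X g f hf).prodMap (liftFree Y g' f' hf')) from h_le
  refine freeRel_le (fun b => ?_) fun P hP h_alt => ?_
  · simpa only [Submodule.mem_comap, LinearMap.prodMap_apply, liftFree_base] using h_base b
  · rw [Submodule.mem_comap, LinearMap.prodMap_apply,
      liftFree_tensor _ _ _ _ _ (by simpa using hP) h_alt,
      liftFree_tensor _ _ _ _ _ (by simpa using hP) (RelElt.map_fst_left_eq_right P ▸ h_alt)]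
    exact h_list P hP

section Operators

variable (hR : ∀ k, IsBimodRel (R k)) {k : K}
include hR

theorem lmulList_mem_freeRel (b : B) (P : List (RelElt R)) :
    (lmulList X b (P.map RelElt.left), lmulList Y b (P.map RelElt.right)) ∈ freeRel R := by
  rcases P with _ | ⟨⟨k, x, y, h⟩, P⟩
  · exact base_mem_freeRel b
  · exact tensor_mem_freeRel (⟨k, b • x, b • y, by simpa using (hR k).smul_mem b _ h⟩ :: P)

theorem rmulList_mem_freeRel (b : B) (P : List (RelElt R)) :
    (rmulList X b (P.map RelElt.left), rmulList Y b (P.map RelElt.right)) ∈ freeRel R := by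
  rcases List.eq_nil_or_concat' P with rfl | ⟨P, ⟨k, x, y, h⟩, rfl⟩
  · exact base_mem_freeRel b
  · simpa [RelElt.left, RelElt.right, rmulList_snoc] using tensor_mem_freeRel
      (P ++ [(⟨k, op b • x, op b • y, by simpa using (hR k).op_smul_mem b _ h⟩ : RelElt R)])

theorem joinLeft_mapsTo_freeRel (P : List (RelElt R)) :
    Set.MapsTo (Prod.map (joinLeft X k (P.map RelElt.left)) (joinLeft Y k (P.map RelElt.right)))
      (R k) (freeRel R) := by
  rintro ⟨⟨b, x⟩, ⟨c, y⟩⟩ hq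
  obtain rfl : b = c := (hR k).fst_eq _ hq
  exact (freeRel R).add_mem (lmulList_mem_freeRel hR b P)
    (tensor_mem_freeRel (⟨k, x, y, (hR k).compl_mem hq⟩ :: P))

theorem joinRight_mapsTo_freeRel (P : List (RelElt R)) :
    Set.MapsTo (Prod.map (joinRight X k (P.map RelElt.left)) (joinRight Y k (P.map RelElt.right)))
      (R k) (freeRel R) := by
  rintro ⟨⟨b, x⟩, ⟨c, y⟩⟩ hq
  obtain rfl : b = c := (hR k).fst_eq _ hq
  simpa [joinRight, RelElt.left, RelElt.right] using
    (freeRel R).add_mem (rmulList_mem_freeRel hR b P)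
      (tensor_mem_freeRel (P ++ [(⟨k, x, y, (hR k).compl_mem hq⟩ : RelElt R)]))

theorem lambda_mapsTo_freeRel {a : (X k).leftAlg} {a' : (Y k).leftAlg}
    (ha : Set.MapsTo (Prod.map a.1 a'.1) (R k) (R k)) :
    Set.MapsTo (Prod.map (lambda X k a) (lambda Y k a')) (freeRel R) (freeRel R) := by
  refine liftFree_mapsTo_freeRel _ _
    (fun b => joinLeft_mapsTo_freeRel hR [] (ha ((hR k).base_mem b))) fun P hP => ?_
  rcases P with _ | ⟨⟨j, x, y, h⟩, P⟩
  · exact absurd rfl hP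
  · simp only [List.map_cons, RelElt.left, RelElt.right]
    rcases eq_or_ne j k with rfl | hj
    · simp only [lambdaList_self]
      exact joinLeft_mapsTo_freeRel hR P (ha h)
    · simp only [lambdaList_ne _ _ _ _ _ _ hj]
      have h_join := joinLeft_mapsTo_freeRel hR (⟨j, x, y, h⟩ :: P) (ha (hR k).vacuum_mem)
      simpa only [List.map_cons, RelElt.left, RelElt.right, Prod.map, SetLike.mem_coe] using h_join

theorem rho_mapsTo_freeRel {a : (X k).rightAlg} {a' : (Y k).rightAlg}
    (ha : Set.MapsTo (Prod.map a.1 a'.1) (R k) (R k)) :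
    Set.MapsTo (Prod.map (rho X k a) (rho Y k a')) (freeRel R) (freeRel R) := by
  refine liftFree_mapsTo_freeRel _ _
    (fun b => joinRight_mapsTo_freeRel hR [] (ha ((hR k).base_mem b))) fun P hP => ?_
  rcases List.eq_nil_or_concat' P with rfl | ⟨P, ⟨j, x, y, h⟩, rfl⟩
  · exact absurd rfl hP
  · simp only [List.map_append, List.map_cons, List.map_nil, RelElt.left, RelElt.right]
    rcases eq_or_ne j k with rfl | hj
    · simp only [rhoList_self]
      exact joinRight_mapsTo_freeRel hR P (ha h)
    · simp only [rhoList_ne _ _ _ _ _ _ hj]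
      have h_join := joinRight_mapsTo_freeRel hR (P ++ [⟨j, x, y, h⟩]) (ha (hR k).vacuum_mem)
      simpa only [List.map_append, List.map_cons, List.map_nil, RelElt.left, RelElt.right,
        Prod.map, SetLike.mem_coe] using h_join

theorem proj_mapsTo_freeRel :
    Set.MapsTo (Prod.map (proj X k) (proj Y k)) (freeRel R) (R k) := by
  refine liftFree_mapsTo_freeRel _ _ (hR k).base_mem fun P hP => ?_
  rcases P with _ | ⟨⟨j, x, y, h⟩, _ | ⟨_, _⟩⟩
  · exact absurd rfl hP
  · simp only [List.map_cons, List.map_nil, RelElt.left, RelElt.right, projList]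
    rcases eq_or_ne j k with rfl | hj
    · simpa using h
    · simp only [dif_neg hj]
      exact (R k).zero_mem
  · exact (R k).zero_mem

theorem boolAct_mapsTo_freeRel {T : (X k).Op} {T' : (Y k).Op}
    (hT : Set.MapsTo (Prod.map T T') (R k) (R k)) :
    Set.MapsTo (Prod.map (boolAct X k T) (boolAct Y k T')) (freeRel R) (freeRel R) :=
  ((joinLeft_mapsTo_freeRel hR []).comp hT).comp (proj_mapsTo_freeRel hR)

end Operators

end Relations

/-! ## The distribution of the represented family -/

section Representations

variable {B 𝒜 : Type u} [Ring B] [Algebra ℂ B] [Ring 𝒜] [Algebra ℂ 𝒜] {S : BBSpace B 𝒜}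

section Single

variable {A : FaceTriple S} {M N : Bimod B} (σ : FaceRep A M) (τ : FaceRep A N)

/-- The relation between two representations of a triple spanned by the pairs of vectors which
corresponding words in the letters produce from the two vacuum vectors. -/
def FaceRep.vacuumRel : Submodule ℂ (M.Total × N.Total) :=
  Submodule.span ℂ (Set.range fun w : List (Letter A) =>
    ((w.map σ.act).prod (1, 0), (w.map τ.act).prod (1, 0)))

theorem FaceRep.act_mapsTo_vacuumRel (z : Letter A) :
    Set.MapsTo (Prod.map (σ.act z) (τ.act z)) (σ.vacuumRel τ) (σ.vacuumRel τ) := by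
  suffices h_le : σ.vacuumRel τ ≤ (σ.vacuumRel τ).comap ((σ.act z).prodMap (τ.act z)) from h_le
  refine Submodule.span_le.2 ?_
  rintro _ ⟨w, rfl⟩
  exact Submodule.subset_span ⟨z :: w, by simp⟩

variable {σ τ}

theorem FaceRep.isBimodRel_vacuumRel (h : σ.dist = τ.dist) : IsBimodRel (σ.vacuumRel τ) where
  vacuum_mem := Submodule.subset_span ⟨[], by simp⟩
  smul_mem b q hq := by
    have h_act := σ.act_mapsTo_vacuumRel τ (.left ⟨S.L b, A.L_mem b⟩) hq
    simp only [FaceRep.act, σ.ℓ_L, τ.ℓ_L] at h_act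
    exact h_act
  op_smul_mem b q hq := by
    have h_act := σ.act_mapsTo_vacuumRel τ (.right ⟨S.R b, A.R_mem b⟩) hq
    simp only [FaceRep.act, σ.r_R, τ.r_R] at h_act
    exact h_act
  fst_eq q hq := by
    have h_le : σ.vacuumRel τ ≤ LinearMap.eqLocus (LinearMap.fst ℂ B _ ∘ₗ LinearMap.fst ℂ _ _)
        (LinearMap.fst ℂ B _ ∘ₗ LinearMap.snd ℂ _ _) :=
      Submodule.span_le.2 (Set.range_subset_iff.2 (congrFun h))
    exact h_le hq

end Single

variable {K : Type v} {Γ : K → FaceTriple S} {X Y : K → Bimod B}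

theorem freeAct_mapsTo_freeRel {R : ∀ k, Submodule ℂ ((X k).Total × (Y k).Total)}
    (hR : ∀ k, IsBimodRel (R k)) (σ : ∀ k, FaceRep (Γ k) (X k)) (τ : ∀ k, FaceRep (Γ k) (Y k))
    {k : K} {z : Letter (Γ k)}
    (hz : Set.MapsTo (Prod.map ((σ k).act z) ((τ k).act z)) (R k) (R k)) :
    Set.MapsTo (Prod.map (freeAct σ ⟨k, z⟩) (freeAct τ ⟨k, z⟩)) (freeRel R) (freeRel R) := by
  cases z with
  | left z => exact lambda_mapsTo_freeRel hR hz
  | right z => exact rho_mapsTo_freeRel hR hz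
  | bool z => exact boolAct_mapsTo_freeRel hR hz

theorem freeDist_congr {σ : ∀ k, FaceRep (Γ k) (X k)} {τ : ∀ k, FaceRep (Γ k) (Y k)}
    (h : ∀ k, (σ k).dist = (τ k).dist) : freeDist σ = freeDist τ := by
  have h_mem (w : List (Σ k, Letter (Γ k))) :
      ((w.map (freeAct σ)).prod (1, 0), (w.map (freeAct τ)).prod (1, 0))
        ∈ freeRel fun k => (σ k).vacuumRel (τ k) := by
    induction w with
    | nil => exact base_mem_freeRel 1
    | cons Z w ih =>
      simp only [List.map_cons, List.prod_cons, Module.End.mul_apply]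
      exact freeAct_mapsTo_freeRel (fun k => FaceRep.isBimodRel_vacuumRel (h k)) σ τ
        ((σ Z.1).act_mapsTo_vacuumRel (τ Z.1) Z.2) ih
  exact funext fun w => fst_eq_of_mem_freeRel (h_mem w)

section Inclusion

variable (X) (k : K)

theorem incl_apply (ξ : (X k).Total) : incl X k ξ = (ξ.1, 0) + tensor X [⟨k, ξ.2⟩] := rfl

theorem incl_vacuum : incl X k (1, 0) = (1, 0) := by
  have h_zero : tensor X [⟨k, 0⟩] = 0 := by
    simpa using (isBalanced_tensor X).smul [] [] k 0 0
  rw [incl_apply, h_zero, add_zero]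

theorem incl_fst (ξ : (X k).Total) : (incl X k ξ).1 = ξ.1 := by
  rw [incl_apply, Prod.fst_add, tensor_fst X (by simp), add_zero]

theorem rho_incl (a : (X k).rightAlg) (ξ : (X k).Total) :
    rho X k a (incl X k ξ) = incl X k (a.1 ξ) := by
  have h_base : rho X k a (ξ.1, 0) = incl X k (a.1 (ξ.1, 0)) := liftFree_base X _ _ _ _
  have h_tensor : rho X k a (tensor X [⟨k, ξ.2⟩]) = incl X k (a.1 (0, ξ.2)) :=
    (liftFree_tensor X _ _ _ _ (by simp) (by simp)).trans (rhoList_self X k a.1 ξ.2 [])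
  rw [incl_apply, map_add, h_base, h_tensor, ← map_add, ← map_add, Prod.mk_add_mk, add_zero,
    zero_add]

end Inclusion

theorem freeAct_incl (σ : ∀ k, FaceRep (Γ k) (X k)) (k : K) (z : Letter (Γ k))
    (ξ : (X k).Total) : freeAct σ ⟨k, z⟩ (incl X k ξ) = incl X k ((σ k).act z ξ) := by
  cases z with
  | left z => exact lambda_incl X k _ ξ
  | right z => exact rho_incl X k _ ξ
  | bool z => simp [freeAct, boolAct, proj_incl, FaceRep.act]

theorem freeDist_map_mk (σ : ∀ k, FaceRep (Γ k) (X k)) (k : K) (w : List (Letter (Γ k))) :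
    freeDist σ (w.map (Sigma.mk k)) = (σ k).dist w := by
  have h_prod : ((w.map (Sigma.mk k)).map (freeAct σ)).prod (1, 0)
      = incl X k ((w.map (σ k).act).prod (1, 0)) := by
    induction w with
    | nil => exact (incl_vacuum X k).symm
    | cons z w ih =>
      simp only [List.map_cons, List.prod_cons, Module.End.mul_apply, ih, freeAct_incl]
  rw [freeDist, vacuumExp, h_prod, incl_fst, FaceRep.dist, vacuumExp]

theorem jointDist_map_mk (Γ : K → FaceTriple S) (k : K) (w : List (Letter (Γ k))) :
    jointDist Γ (w.map (Sigma.mk k)) = (Γ k).dist w := by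
  rw [jointDist, List.map_map]
  rfl

theorem IsFFBVia.dist_eq {σ : ∀ k, FaceRep (Γ k) (X k)} (h : IsFFBVia Γ σ) (k : K) :
    (Γ k).dist = (σ k).dist := by
  funext w
  rw [← jointDist_map_mk, h, freeDist_map_mk]

theorem IsFFB.isFFBVia (h : IsFFB Γ) {σ : ∀ k, FaceRep (Γ k) (X k)}
    (hσ : ∀ k, (Γ k).dist = (σ k).dist) : IsFFBVia Γ σ := by
  obtain ⟨Y, τ, hτ⟩ := h
  exact Eq.trans hτ (freeDist_congr fun k => (hτ.dist_eq k).symm.trans (hσ k))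

theorem IsFFB.E_one (h : IsFFB Γ) : S.E 1 = 1 := by
  obtain ⟨X, σ, hσ⟩ := h
  simpa [jointDist, freeDist, vacuumExp] using congrFun hσ []

end Representations

/-! ## The cyclic representation -/

section Cyclic

variable {B 𝒜 : Type u} [Ring B] [Algebra ℂ B] [Ring 𝒜] [Algebra ℂ 𝒜]

/-- A module over an algebra with a homomorphism from `B ⊗ Bᵒᵖ`, as a `B`-`B`-bimodule. -/
def Bimod.ofModule (f : B ⊗[ℂ] Bᵐᵒᵖ →ₐ[ℂ] 𝒜) (W : Type u) [AddCommGroup W] [Module ℂ W]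
    [Module 𝒜 W] [IsScalarTower ℂ 𝒜 W] : Bimod B :=
  letI : Module B W := Module.compHom W (f.comp Algebra.TensorProduct.includeLeft).toRingHom
  letI : Module Bᵐᵒᵖ W := Module.compHom W (f.comp Algebra.TensorProduct.includeRight).toRingHom
  { carrier := W
    commActions := ⟨fun b c x => by
      change f (b ⊗ₜ 1) • f (1 ⊗ₜ c) • x = f (1 ⊗ₜ c) • f (b ⊗ₜ 1) • x
      simp only [smul_smul, ← map_mul, Algebra.TensorProduct.tmul_mul_tmul, mul_one, one_mul]⟩
    towerLeft := ⟨fun z b x => by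
      change f ((z • b) ⊗ₜ 1) • x = z • f (b ⊗ₜ 1) • x
      rw [← TensorProduct.smul_tmul', map_smul, smul_assoc]⟩
    towerRight := ⟨fun z b x => by
      change f (1 ⊗ₜ (z • b)) • x = z • f (1 ⊗ₜ b) • x
      rw [TensorProduct.tmul_smul, map_smul, smul_assoc]⟩ }

namespace BBSpace

variable (S : BBSpace B 𝒜)

theorem commute_L_R (b c : B) : Commute (S.L b) (S.R c) := by
  simp only [Commute, SemiconjBy, L, R, ← map_mul, Algebra.TensorProduct.tmul_mul_tmul, mul_one,
    one_mul]

theorem L_mul (b c : B) : S.L (b * c) = S.L b * S.L c := by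
  simp only [L, ← map_mul, Algebra.TensorProduct.tmul_mul_tmul, mul_one]

theorem E_mul_L_sub_R (a : 𝒜) (b : B) : S.E (a * (S.L b - S.R b)) = 0 := by
  rw [mul_sub, map_sub, sub_eq_zero]
  exact S.E_balanced b a

/-- The left ideal `∑_b 𝒜 (L_b - R_b)`, on which the expectation vanishes. -/
def balancingIdeal : Ideal 𝒜 := Ideal.span (Set.range fun b => S.L b - S.R b)

theorem E_eq_zero_of_mem_balancingIdeal {T : 𝒜} (hT : T ∈ S.balancingIdeal) : S.E T = 0 := by
  suffices h_mul : ∀ a, S.E (a * T) = 0 by simpa only [one_mul] using h_mul 1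
  induction hT using Submodule.span_induction with
  | mem T hT =>
    obtain ⟨b, rfl⟩ := hT
    exact fun a => S.E_mul_L_sub_R a b
  | zero => simp
  | add T U _ _ hT hU => simp [mul_add, hT, hU]
  | smul c T _ hT => exact fun a => by simpa only [smul_eq_mul, mul_assoc] using hT (a * c)

/-- The cyclic left `𝒜`-module `𝒜 / ∑_b 𝒜 (L_b - R_b)`. -/
abbrev CyclicModule : Type u := 𝒜 ⧸ S.balancingIdeal

/-- The class of an element of `𝒜` in the cyclic module. -/
abbrev cyclicMk : 𝒜 →ₗ[𝒜] S.CyclicModule := S.balancingIdeal.mkQ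

theorem cyclicMk_L (b : B) : S.cyclicMk (S.L b) = S.cyclicMk (S.R b) :=
  (Submodule.Quotient.eq _).2 (Submodule.subset_span ⟨b, rfl⟩)

/-- The map which the expectation induces on the cyclic module. -/
def cyclicExp : S.CyclicModule →ₗ[ℂ] B :=
  (S.balancingIdeal.restrictScalars ℂ).liftQ S.E (fun _ => S.E_eq_zero_of_mem_balancingIdeal)
    ∘ₗ (Submodule.Quotient.restrictScalarsEquiv ℂ S.balancingIdeal).symm.toLinearMap

theorem cyclicExp_mk (a : 𝒜) : S.cyclicExp (S.cyclicMk a) = S.E a := rfl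

theorem cyclicExp_smul (b c : B) (v : S.CyclicModule) :
    S.cyclicExp (S.ε (b ⊗ₜ op c) • v) = b * S.cyclicExp v * c := by
  obtain ⟨a, rfl⟩ := S.balancingIdeal.mkQ_surjective v
  rw [← map_smul, cyclicExp_mk, smul_eq_mul, S.E_bimodule, cyclicExp_mk]

theorem cyclicExp_L_smul (b : B) (v : S.CyclicModule) :
    S.cyclicExp (S.L b • v) = b * S.cyclicExp v := by
  simpa [L] using S.cyclicExp_smul b 1 v

/-- The kernel of the expectation on the cyclic module. It is only stable under the image of `ε`. -/
def cyclicCompl : Submodule S.ε.range S.CyclicModule where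
  toAddSubmonoid := (LinearMap.ker S.cyclicExp).toAddSubmonoid
  smul_mem' := by
    rintro ⟨_, t, rfl⟩ v (hv : S.cyclicExp v = 0)
    change S.cyclicExp (S.ε t • v) = 0
    induction t using TensorProduct.induction_on with
    | zero => simp
    | tmul b c => rw [← op_unop c, cyclicExp_smul, hv, mul_zero, zero_mul]
    | add t u ht hu => rw [map_add, add_smul, map_add, ht, hu, add_zero]

/-- The `B`-`B`-bimodule with specified projection `B ⊕ ker E` on the cyclic module, its left and
right actions being those of `L_b` and `R_b`. -/
def cyclicBimod : Bimod B := Bimod.ofModule S.ε.rangeRestrict S.cyclicCompl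

/-- The inclusion of the complement of `B` in the cyclic module. -/
def cyclicIncl : S.cyclicBimod.carrier →ₗ[ℂ] S.CyclicModule :=
  S.cyclicCompl.subtype.restrictScalars ℂ

/-- The copy `b ↦ L_b` of `B` in the cyclic module. -/
def cyclicBase : B →ₗ[ℂ] S.CyclicModule :=
  S.cyclicMk.restrictScalars ℂ ∘ₗ S.ε.toLinearMap ∘ₗ
    (Algebra.TensorProduct.includeLeft : B →ₐ[ℂ] B ⊗[ℂ] Bᵐᵒᵖ).toLinearMap

theorem cyclicBase_apply (b : B) : S.cyclicBase b = S.cyclicMk (S.L b) := rfl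

theorem cyclicBase_one : S.cyclicBase 1 = S.cyclicMk 1 := by
  rw [cyclicBase_apply, L, ← Algebra.TensorProduct.one_def, map_one]

theorem L_smul_cyclicBase (b c : B) : S.L b • S.cyclicBase c = S.cyclicBase (b * c) := by
  rw [cyclicBase_apply, cyclicBase_apply, L_mul, ← map_smul, smul_eq_mul]

theorem R_smul_cyclicBase (b c : B) : S.R b • S.cyclicBase c = S.cyclicBase (c * b) := by
  rw [cyclicBase_apply, cyclicBase_apply, L_mul, ← smul_eq_mul (S.L c), map_smul, cyclicMk_L S b,
    ← map_smul, ← map_smul, smul_eq_mul, smul_eq_mul, (S.commute_L_R c b).eq]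

variable {S}

theorem cyclicExp_base (h_one : S.E 1 = 1) (b : B) : S.cyclicExp (S.cyclicBase b) = b := by
  rw [← mul_one b, ← L_smul_cyclicBase, cyclicExp_L_smul, cyclicBase_one, cyclicExp_mk, h_one]

/-- The decomposition of the cyclic module into the copy of `B` and the kernel of the
expectation. -/
def cyclicEquiv (h_one : S.E 1 = 1) : S.cyclicBimod.Total ≃ₗ[ℂ] S.CyclicModule where
  toLinearMap := S.cyclicBase.coprod S.cyclicIncl
  invFun v := (S.cyclicExp v, ⟨v - S.cyclicBase (S.cyclicExp v), by
    change S.cyclicExp (v - S.cyclicBase (S.cyclicExp v)) = 0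
    rw [map_sub, cyclicExp_base h_one, sub_self]⟩)
  left_inv := by
    rintro ⟨b, x⟩
    have h_exp : S.cyclicExp (S.cyclicBase b + S.cyclicIncl x) = b := by
      rw [map_add, cyclicExp_base h_one, show S.cyclicExp (S.cyclicIncl x) = 0 from x.2, add_zero]
    refine Prod.ext h_exp (Subtype.ext ?_)
    change S.cyclicBase b + S.cyclicIncl x
      - S.cyclicBase (S.cyclicExp (S.cyclicBase b + S.cyclicIncl x)) = S.cyclicIncl x
    rw [h_exp, add_sub_cancel_left]
  right_inv v := add_sub_cancel (S.cyclicBase (S.cyclicExp v)) v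

theorem cyclicEquiv_base (h_one : S.E 1 = 1) (b : B) :
    cyclicEquiv h_one (b, 0) = S.cyclicBase b := by
  change S.cyclicBase b + S.cyclicIncl 0 = S.cyclicBase b
  rw [map_zero, add_zero]

theorem cyclicEquiv_smul (h_one : S.E 1 = 1) (b : B) (ξ : S.cyclicBimod.Total) :
    cyclicEquiv h_one (b • ξ) = S.L b • cyclicEquiv h_one ξ := by
  change S.cyclicBase (b * ξ.1) + S.L b • S.cyclicIncl ξ.2
    = S.L b • (S.cyclicBase ξ.1 + S.cyclicIncl ξ.2)
  rw [smul_add, L_smul_cyclicBase]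

theorem cyclicEquiv_op_smul (h_one : S.E 1 = 1) (b : B) (ξ : S.cyclicBimod.Total) :
    cyclicEquiv h_one (op b • ξ) = S.R b • cyclicEquiv h_one ξ := by
  change S.cyclicBase (ξ.1 * b) + S.R b • S.cyclicIncl ξ.2
    = S.R b • (S.cyclicBase ξ.1 + S.cyclicIncl ξ.2)
  rw [smul_add, R_smul_cyclicBase]

/-- The representation of `𝒜` on `B ⊕ ker E` given by its action on the cyclic module. -/
def cyclicRep (h_one : S.E 1 = 1) : 𝒜 →ₐ[ℂ] S.cyclicBimod.Op :=
  ((cyclicEquiv h_one).symm.conjAlgEquiv ℂ).toAlgHom.comp (Algebra.lsmul ℂ ℂ S.CyclicModule)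

theorem cyclicEquiv_cyclicRep (h_one : S.E 1 = 1) (a : 𝒜) (ξ : S.cyclicBimod.Total) :
    cyclicEquiv h_one (cyclicRep h_one a ξ) = a • cyclicEquiv h_one ξ :=
  (cyclicEquiv h_one).apply_symm_apply _

theorem cyclicRep_L (h_one : S.E 1 = 1) (b : B) :
    cyclicRep h_one (S.L b) = S.cyclicBimod.L b := by
  refine LinearMap.ext fun ξ => (cyclicEquiv h_one).injective ?_
  exact (cyclicEquiv_cyclicRep h_one _ ξ).trans (cyclicEquiv_smul h_one b ξ).symm

theorem cyclicRep_R (h_one : S.E 1 = 1) (b : B) :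
    cyclicRep h_one (S.R b) = S.cyclicBimod.R b := by
  refine LinearMap.ext fun ξ => (cyclicEquiv h_one).injective ?_
  exact (cyclicEquiv_cyclicRep h_one _ ξ).trans (cyclicEquiv_op_smul h_one b ξ).symm

theorem vacuumExp_cyclicRep (h_one : S.E 1 = 1) (a : 𝒜) :
    vacuumExp (cyclicRep h_one a) = S.E a := by
  change S.cyclicExp (a • cyclicEquiv h_one (1, 0)) = S.E a
  rw [cyclicEquiv_base, cyclicBase_one, ← map_smul, smul_eq_mul, mul_one, cyclicExp_mk]

theorem cyclicRep_mem_leftAlg (h_one : S.E 1 = 1) {a : 𝒜} (ha : a ∈ S.leftAlg) :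
    cyclicRep h_one a ∈ S.cyclicBimod.leftAlg := by
  rw [Bimod.leftAlg, Subalgebra.mem_centralizer_iff]
  rintro _ ⟨b, rfl⟩
  rw [← cyclicRep_R h_one, ← map_mul, ← map_mul,
    (Subalgebra.mem_centralizer_iff ℂ).1 ha _ ⟨b, rfl⟩]

theorem cyclicRep_mem_rightAlg (h_one : S.E 1 = 1) {a : 𝒜} (ha : a ∈ S.rightAlg) :
    cyclicRep h_one a ∈ S.cyclicBimod.rightAlg := by
  rw [Bimod.rightAlg, Subalgebra.mem_centralizer_iff]
  rintro _ ⟨b, rfl⟩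
  rw [← cyclicRep_L h_one, ← map_mul, ← map_mul,
    (Subalgebra.mem_centralizer_iff ℂ).1 ha _ ⟨b, rfl⟩]

end BBSpace

variable {S : BBSpace B 𝒜}

/-- The representation of a triple of faces on the cyclic module. -/
def FaceTriple.cyclicRep (A : FaceTriple S) (h_one : S.E 1 = 1) : FaceRep A S.cyclicBimod where
  ℓ := ((BBSpace.cyclicRep h_one).comp A.left.val).codRestrict _
    fun z => BBSpace.cyclicRep_mem_leftAlg h_one (A.left_le z.2)
  r := ((BBSpace.cyclicRep h_one).comp A.right.val).codRestrict _
    fun z => BBSpace.cyclicRep_mem_rightAlg h_one (A.right_le z.2)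
  m := (BBSpace.cyclicRep h_one : 𝒜 →ₙₐ[ℂ] S.cyclicBimod.Op).comp
    (NonUnitalSubalgebraClass.subtype A.bool)
  ℓ_L := BBSpace.cyclicRep_L h_one
  r_R := BBSpace.cyclicRep_R h_one

theorem FaceTriple.dist_cyclicRep (A : FaceTriple S) (h_one : S.E 1 = 1) :
    (A.cyclicRep h_one).dist = A.dist := by
  have h_act (z : Letter A) : (A.cyclicRep h_one).act z = BBSpace.cyclicRep h_one z.val := by
    cases z <;> rfl
  funext w
  rw [FaceRep.dist, FaceTriple.dist, ← BBSpace.vacuumExp_cyclicRep h_one, map_list_prod,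
    List.map_map]
  exact congrArg (fun f => vacuumExp (w.map f).prod) (funext h_act)

end Cyclic

/-! ## Images of triples of faces -/

section Images

variable {B 𝒜 𝒜' : Type u} [Ring B] [Algebra ℂ B] [Ring 𝒜] [Algebra ℂ 𝒜] [Ring 𝒜'] [Algebra ℂ 𝒜']
  {S : BBSpace B 𝒜} {S' : BBSpace B 𝒜'}

section Single

variable {A : FaceTriple S} {A' : FaceTriple S'} (φ : FaceImage A A')

theorem FaceImage.map_surjective : Function.Surjective φ.map := by
  rintro (z | z | z)
  · obtain ⟨y, rfl⟩ := φ.left_surjective z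
    exact ⟨.left y, rfl⟩
  · obtain ⟨y, rfl⟩ := φ.right_surjective z
    exact ⟨.right y, rfl⟩
  · obtain ⟨y, rfl⟩ := φ.bool_surjective z
    exact ⟨.bool y, rfl⟩

/-- The representation of a triple of faces obtained from one of its image. -/
def FaceRep.pullback {M : Bimod B} (σ : FaceRep A' M) : FaceRep A M where
  ℓ := σ.ℓ.comp φ.left
  r := σ.r.comp φ.right
  m := σ.m.comp φ.bool
  ℓ_L b := by
    have h_L : φ.left ⟨S.L b, A.L_mem b⟩ = ⟨S'.L b, A'.L_mem b⟩ := Subtype.ext (φ.left_L b)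
    rw [AlgHom.comp_apply, h_L, σ.ℓ_L]
  r_R b := by
    have h_R : φ.right ⟨S.R b, A.R_mem b⟩ = ⟨S'.R b, A'.R_mem b⟩ := Subtype.ext (φ.right_R b)
    rw [AlgHom.comp_apply, h_R, σ.r_R]

theorem FaceRep.dist_pullback {M : Bimod B} (σ : FaceRep A' M) :
    (σ.pullback φ).dist = σ.dist ∘ List.map φ.map := by
  funext w
  rw [FaceRep.dist, Function.comp_apply, FaceRep.dist, List.map_map]
  refine congrArg (fun f => vacuumExp (w.map f).prod) (funext fun z => ?_)
  cases z <;> rfl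

end Single

variable {K : Type v} {Γ : K → FaceTriple S} {Γ' : K → FaceTriple S'}
  (φ : ∀ k, FaceImage (Γ k) (Γ' k))

/-- The image of a letter of a family of triples of faces. -/
def mapLetters : (Σ k, Letter (Γ k)) → Σ k, Letter (Γ' k) :=
  Sigma.map id fun k => (φ k).map

theorem mapLetters_surjective : Function.Surjective (mapLetters φ) :=
  Function.surjective_id.sigma_map fun k => (φ k).map_surjective

theorem freeDist_pullback {X : K → Bimod B} (σ : ∀ k, FaceRep (Γ' k) (X k)) :
    freeDist (fun k => (σ k).pullback (φ k)) = freeDist σ ∘ List.map (mapLetters φ) := by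
  funext w
  rw [freeDist, Function.comp_apply, freeDist, List.map_map]
  refine congrArg (fun f => vacuumExp (w.map f).prod) (funext fun Z => ?_)
  obtain ⟨k, z | z | z⟩ := Z <;> rfl

variable {φ}

theorem dist_eq_of_jointDist_eq (h : jointDist Γ = jointDist Γ' ∘ List.map (mapLetters φ))
    (k : K) : (Γ k).dist = (Γ' k).dist ∘ List.map (φ k).map := by
  funext w
  rw [← jointDist_map_mk, h, Function.comp_apply, Function.comp_apply, ← jointDist_map_mk,
    List.map_map, List.map_map]
  rfl

theorem isFFBVia_pullback_iff (h : jointDist Γ = jointDist Γ' ∘ List.map (mapLetters φ))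
    {X : K → Bimod B} (σ : ∀ k, FaceRep (Γ' k) (X k)) :
    IsFFBVia Γ (fun k => (σ k).pullback (φ k)) ↔ IsFFBVia Γ' σ := by
  rw [IsFFBVia, IsFFBVia, h, freeDist_pullback]
  exact (List.map_surjective_iff.2 (mapLetters_surjective φ)).injective_comp_right.eq_iff

theorem IsFFB.jointDist_eq (h : IsFFB Γ) (h' : IsFFB Γ')
    (hd : ∀ k, (Γ k).dist = (Γ' k).dist ∘ List.map (φ k).map) :
    jointDist Γ = jointDist Γ' ∘ List.map (mapLetters φ) := by
  obtain ⟨X, σ, hσ⟩ := h'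
  have h_dist (k : K) : (Γ k).dist = ((σ k).pullback (φ k)).dist := by
    rw [FaceRep.dist_pullback, ← hσ.dist_eq, hd]
  have h_via : jointDist Γ = freeDist fun k => (σ k).pullback (φ k) := h.isFFBVia h_dist
  rw [h_via, freeDist_pullback, hσ]

theorem E_one_eq_of_jointDist_eq (h : jointDist Γ = jointDist Γ' ∘ List.map (mapLetters φ)) :
    S.E 1 = S'.E 1 := by
  simpa [jointDist] using congrFun h []

theorem isFFB_iff_of_jointDist_eq (h : jointDist Γ = jointDist Γ' ∘ List.map (mapLetters φ)) :
    IsFFB Γ ↔ IsFFB Γ' := by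
  refine ⟨fun hΓ => ?_, fun ⟨X, σ, hσ⟩ => ⟨X, _, (isFFBVia_pullback_iff h σ).2 hσ⟩⟩
  have h_one : S'.E 1 = 1 := (E_one_eq_of_jointDist_eq h).symm.trans hΓ.E_one
  refine ⟨_, _, (isFFBVia_pullback_iff h fun k => (Γ' k).cyclicRep h_one).1 ?_⟩
  refine hΓ.isFFBVia fun k => ?_
  rw [FaceRep.dist_pullback, FaceTriple.dist_cyclicRep, dist_eq_of_jointDist_eq h]

end Images

end FFB

end

theorem mainTheorem5 {B 𝒜 : Type u} [Ring B] [Algebra ℂ B] [Ring 𝒜] [Algebra ℂ 𝒜]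
    (S : BBSpace B 𝒜) {K : Type v} (Γ : K → FaceTriple S)
    (X' : K → Bimod B) (ρ' : ∀ k, FaceRep (Γ k) (X' k))
    (hdist : ∀ k, (Γ k).dist = (ρ' k).dist) :
    (IsFFB Γ ↔ IsFFBVia Γ ρ') ∧
    (IsFFB Γ → jointDist Γ = freeDist ρ') ∧
    (∀ (𝒜' : Type u) [Ring 𝒜'] [Algebra ℂ 𝒜'] (S' : BBSpace B 𝒜') (Γ' : K → FaceTriple S')
      (φ : ∀ k, FaceImage (Γ k) (Γ' k)),
      (∀ k, (Γ k).dist = fun w => (Γ' k).dist (w.map (φ k).map)) →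
      (IsFFB Γ → IsFFB Γ' →
        jointDist Γ = fun w => jointDist Γ' (w.map fun Z => ⟨Z.1, (φ Z.1).map Z.2⟩)) ∧
      (jointDist Γ = (fun w => jointDist Γ' (w.map fun Z => ⟨Z.1, (φ Z.1).map Z.2⟩)) →
        (IsFFB Γ ↔ IsFFB Γ'))) := by
  refine ⟨⟨fun h => h.isFFBVia hdist, fun h => ⟨X', ρ', h⟩⟩, fun h => h.isFFBVia hdist, ?_⟩
  intro 𝒜' _ _ S' Γ' φ hd
  exact ⟨fun h h' => h.jointDist_eq h' hd, isFFB_iff_of_jointDist_eq⟩
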